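/- Let $G=(V,E,\omega)$ be a weighted undirected graph with vertex set $V=\{0,\dots,n-1\}$, $n\ge 3$, and non-negative real edge weights, and let $d_G(u,v)\in[0,\infty]$ be the shortest path distance ($\infty$ if $u,v$ are not connected). For a set $H$ of pairs of vertices at finite distance (self-loops allowed), $G\cup H$ is the graph in which every pair $uv\in H$ has weight $d_G(u,v)$ and every edge $uv\in E\setminus H$ has weight $\omega(uv)$; $H$ is a *$3$-hopset* of $G$ if for all $u,v$ the least length of a $u$–$v$ walk with at most $3$ edges in $G\cup H$ is $d_G(u,v)$. We say that $G$ has treewidth (at most) $t$ if there are a finite tree $T$ and bags $X_i\subseteq V$ ($i\in V(T)$) with $|X_i|\le t+1$ such that both ends of every edge of $G$ lie in a common bag and, for every $v\in V$, the nodes $i$ with $v\in X_i$ form a non-empty subtree of $T$. A *$3$-hopset distance oracle* for $G$ stores, for every vertex $w$, a list of first/last-hop neighbours $x\in N_1(w)$ with the lengths $d_G(w,x)$, and a hash map that maps every pair $\{x,y\}$ of a set $H_2$ (middle hops) to $d_G(x,y)$; all stored lengths are finite. It is required that $H_1\cup H_2$, where $H_1=\{wx : x\in N_1(w)\}$, is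 a $3$-hopset of $G$, and that for all $u,v$ with $d_G(u,v)<\infty$ there are $x\in N_1(u)$, $y\in N_1(v)$ with $\{x,y\}\in H_2$ and $d_G(u,v)=d_G(u,x)+d_G(x,y)+d_G(y,v)$. The number of stored edges is $|E|+\sum_w|N_1(w)|+|H_2|$. A query for $(u,v)$ computes $$\min_{x\in N_1(u),\,y\in N_1(v):\,\{x,y\}\in H_2}\bigl(d_G(u,x)+d_G(x,y)+d_G(y,v)\bigr)\qquad(\min\emptyset=\infty)$$ by two nested loops through the lists $N_1(u)$ and $N_1(v)$; its time is the number of elementary operations performed, where fetching a list or the next list entry, a hash map look-up, an addition, and a comparison with update take unit time each. **Theorem.** There is an absolute constant $C>0$ such that for all integers $n\ge3$ and $t\ge1$, every graph $G$ as above of treewidth (at most) $t$ has a $3$-hopset distance oracle with the following properties. 1. The number of stored edges is at most $C\,t\,n\log_2\log_2 n$. 2. Every vertex $w$ has at most $C\,t\log_2\log_2 n$ first/last-hop neighbours. 3. For all $u,v$, the query for $(u,v)$ returns $d_G(u,v)$ in time at most $C\,t^2(\log_2\log_2 n)^2$. 4. Each stored edge takes $O(\log n)$ bits if the weights do: for every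 integer $c\ge0$, if all edge weights are integers at most $n^c$, then there is $b\le C(c+1)\log_2 n$ such that the two vertices and the length of every stored edge are non-negative integers below $2^b$. -/

import Mathlib

open scoped NNReal ENNReal

noncomputable section

namespace HopOracle

/-! ### Weighted graphs and distances -/

/-- A weighted undirected graph. Only the weights of adjacent pairs matter. -/
structure WeightedGraph (V : Type) where
  graph : SimpleGraph V
  weight : V → V → ℝ≥0
  weight_symm : ∀ u v, weight u v = weight v u

/-- The length of a walk with respect to an edge length function `l`. -/
def walkLength {V : Type} {G : SimpleGraph V} (l : V → V → ℝ≥0∞) {u v : V}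
    (p : G.Walk u v) : ℝ≥0∞ :=
  (p.darts.map fun d => l d.fst d.snd).sum

/-- The `h`-limited distance: the least length of a walk with at most `h` edges
(`⊤` if there is none). -/
def hopDist {V : Type} (G : SimpleGraph V) (l : V → V → ℝ≥0∞) (h : ℕ) (u v : V) : ℝ≥0∞ :=
  ⨅ p : {p : G.Walk u v // p.length ≤ h}, walkLength l p.1

namespace WeightedGraph

variable {V : Type}

/-- The shortest path distance (`⊤` for two vertices in different components). -/
def dist (G : WeightedGraph V) (u v : V) : ℝ≥0∞ :=
  ⨅ p : G.graph.Walk u v, walkLength (fun x y => (G.weight x y : ℝ≥0∞)) p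

/-- The graph underlying `G ∪ H`. Self-loops in `H` are dropped, which does not change any
`h`-limited distance. -/
def augGraph (G : WeightedGraph V) (H : Set (Sym2 V)) : SimpleGraph V :=
  G.graph ⊔ SimpleGraph.fromEdgeSet H

open Classical in
/-- The edge lengths of `G ∪ H`: a pair in `H` has length the distance of its ends in `G`, the
other edges of `G` keep their weight. -/
def augLength (G : WeightedGraph V) (H : Set (Sym2 V)) (u v : V) : ℝ≥0∞ :=
  if s(u, v) ∈ H then G.dist u v else G.weight u v

/-- `H` is an exact `h`-hopset of `G`: its edges have finite (real) length, and the `h`-limited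
distances of `G ∪ H` are the distances of `G`. -/
def IsHopset (G : WeightedGraph V) (h : ℕ) (H : Set (Sym2 V)) : Prop :=
  (∀ u v, s(u, v) ∈ H → G.dist u v ≠ ⊤) ∧
  ∀ u v, hopDist (G.augGraph H) (G.augLength H) h u v = G.dist u v

end WeightedGraph

/-! ### Treewidth -/

/-- `G` has a tree decomposition all of whose bags have at most `t + 1` vertices. The bags
containing a given vertex form a (non-empty) subtree. -/
def HasTreewidth {V : Type} (G : SimpleGraph V) (t : ℕ) : Prop :=
  ∃ (ι : Type) (_ : Finite ι) (T : SimpleGraph ι) (bag : ι → Finset V),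
    T.IsTree ∧
    (∀ i, (bag i).card ≤ t + 1) ∧
    (∀ u v, G.Adj u v → ∃ i, u ∈ bag i ∧ v ∈ bag i) ∧
    (∀ u, (T.induce {i | u ∈ bag i}).Connected)

/-! ### Computations that count their elementary operations -/

/-- A result together with the number of elementary operations spent on it. -/
structure Timed (α : Type) where
  val : α
  time : ℕ

instance : Monad Timed where
  pure a := ⟨a, 0⟩
  bind x f := ⟨(f x.val).val, x.time + (f x.val).time⟩

/-- An elementary operation: it takes one unit of time. -/
def Timed.op {α : Type} (a : α) : Timed α := ⟨a, 1⟩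

/-! ### The data structure of a 3-hopset distance oracle -/

/-- What is stored besides the graph: for every vertex `w` the list of pairs `(x, d)` of a
first/last-hop neighbour `x` of `w` and the length `d` of the arc `(w, x)`, and a hash map from
unordered pairs of vertices (the middle hops) to their lengths. -/
structure Store (n : ℕ) where
  hops : Fin n → List (Fin n × ℝ≥0)
  links : Sym2 (Fin n) → Option ℝ≥0

namespace Store

variable {n : ℕ}

/-- The first and last hops, without orientation. -/
def H₁ (S : Store n) : Set (Sym2 (Fin n)) :=
  {e | ∃ w x d, (x, d) ∈ S.hops w ∧ e = s(w, x)}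

/-- The middle hops: the keys of the hash map. -/
def H₂ (S : Store n) : Set (Sym2 (Fin n)) :=
  {e | (S.links e).isSome}

/-- The number of stored edges: the edges of `G`, the arcs of the first/last hops and the middle
hops. -/
def size (G : WeightedGraph (Fin n)) (S : Store n) : ℕ :=
  G.graph.edgeSet.ncard + ∑ w, (S.hops w).length + S.H₂.ncard

/-- The stored edges as records `(x, y, d)` of two vertices and a length. -/
def records (G : WeightedGraph (Fin n)) (S : Store n) : Set (Fin n × Fin n × ℝ≥0) :=
  {r | (G.graph.Adj r.1 r.2.1 ∧ r.2.2 = G.weight r.1 r.2.1) ∨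
    (r.2.1, r.2.2) ∈ S.hops r.1 ∨ S.links s(r.1, r.2.1) = some r.2.2}

/-- `S` is a 3-hopset distance oracle for `G`: the stored lengths are the distances in `G`, the
stored pairs `H₁ ∪ H₂` are a 3-hopset, and any two vertices at finite distance are joined by a
shortest path `u, x, y, v` in which `(u, x)` and `(v, y)` are stored arcs and `{x, y}` is a stored
middle hop. -/
structure IsThreeHopsetOracle (G : WeightedGraph (Fin n)) (S : Store n) : Prop where
  hops_length : ∀ w x d, (x, d) ∈ S.hops w → (d : ℝ≥0∞) = G.dist w x
  links_length : ∀ x y d, S.links s(x, y) = some d → (d : ℝ≥0∞) = G.dist x y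
  hopset : G.IsHopset 3 (S.H₁ ∪ S.H₂)
  covers : ∀ u v, G.dist u v ≠ ⊤ → ∃ x y a b, (x, a) ∈ S.hops u ∧ (y, b) ∈ S.hops v ∧
    s(x, y) ∈ S.H₂ ∧ G.dist u v = G.dist u x + G.dist x y + G.dist y v

/-! ### The query algorithm

Elementary operations: fetching the list of a vertex, fetching the next list entry (or noticing
the end of the list), a hash map look-up, an addition, and a comparison with update. -/

/-- Look up the middle hop `{x, y}` and improve the best length found so far. -/
def relax (S : Store n) (x : Fin n) (a : ℝ≥0) (y : Fin n) (b : ℝ≥0) (best : ℝ≥0∞) :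
    Timed ℝ≥0∞ := do
  let r ← Timed.op (S.links s(x, y))
  match r with
  | none => pure best
  | some m => do
    let p ← Timed.op (a + m)
    let q ← Timed.op (p + b)
    Timed.op (min best (q : ℝ≥0∞))

/-- Run through the last-hop neighbours `y` for a fixed first hop `x`. -/
def scanLast (S : Store n) (x : Fin n) (a : ℝ≥0) :
    List (Fin n × ℝ≥0) → ℝ≥0∞ → Timed ℝ≥0∞
  | [], best => Timed.op best
  | e :: l, best => do
    let f ← Timed.op e
    let best' ← S.relax x a f.1 f.2 best
    S.scanLast x a l best'

/-- Run through the first-hop neighbours `x`. -/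
def scanFirst (S : Store n) (v : Fin n) : List (Fin n × ℝ≥0) → ℝ≥0∞ → Timed ℝ≥0∞
  | [], best => Timed.op best
  | e :: l, best => do
    let f ← Timed.op e
    let lv ← Timed.op (S.hops v)
    let best' ← S.scanLast f.1 f.2 lv best
    S.scanFirst v l best'

/-- The distance query for the pair `u, v`. It reads nothing but the store. -/
def query (S : Store n) (u v : Fin n) : Timed ℝ≥0∞ := do
  let lu ← Timed.op (S.hops u)
  S.scanFirst v lu ⊤

end Store

end HopOracle

end

namespace HopOracle

/-! The hops are chosen without looking at the weights. By `exists_splitsWalks`, every walk from `u`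
to `v` passes through some `x` in `N u` and then some `y` in `N v` with `s(x, y)` in `H`; splitting
a shortest path in this way gives the exact distance.

The hops come from a recursion on a vertex set `A`. A separator `S` of size O(√(t|A|)) leaves pieces
of at most √(t|A|) vertices, each with at most `2 * t` neighbours in `S`. All pairs in `S` become
middle hops, O(t|A|) of them, and the neighbours of its piece become hops of each vertex. A walk
that meets `S` is split where it first and last meets `S`; any other walk stays in one piece and is
left to the recursion. Each level turns a size bound t·M into t·√M, so about log log n levels
suffice.

The separator (`exists_separator`) comes from an elimination order, which a rooted tree
decomposition provides. In the elimination forest of `A`, the upper neighbours of a vertex are among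
its ancestors. `exists_forest_cut` removes at most 2|A|/m vertices `Q`, so that pieces have less
than `m` vertices and at most one vertex of `Q` below them; `S` is `Q` with its upper neighbours in
`A`. A piece then touches `S` only in upper neighbours of its root and of the vertex of `Q` below
it. -/

/-! ### Elimination orders from tree decompositions. -/

/-- An elimination order of `G` of width `t`: in the order of decreasing rank, the later neighbours
of a vertex `v` are among the at most `t` vertices of `up v`, and the set `up v` is a clique of the
graph in which every vertex `x` is joined to `up x`. -/
structure EliminationOrder {V : Type} (G : SimpleGraph V) (t : ℕ) where
  rank : V → ℕ
  up : V → Finset V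
  rank_injective : Function.Injective rank
  rank_lt : ∀ {v x}, x ∈ up v → rank x < rank v
  mem_up : ∀ {u v}, G.Adj u v → u ∈ up v ∨ v ∈ up u
  clique : ∀ {v x y}, x ∈ up v → y ∈ up v → rank y < rank x → y ∈ up x
  card_up : ∀ v, (up v).card ≤ t

/-- In a tree rooted at `r`, let `a` be a node of the connected set `X` nearest to the root. The
path from the root to a node of `X` passes through `a` and is in `X` from there on. -/
theorem exists_path_through_top {ι : Type} {T : SimpleGraph ι} (hT : T.IsTree) (r : ι)
    {X : Set ι} (hX : (T.induce X).Connected) {a i : ι} (ha : a ∈ X) (hi : i ∈ X)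
    (hmin : ∀ j ∈ X, T.dist r a ≤ T.dist r j) :
    ∃ P : T.Walk r i, P.IsPath ∧ a ∈ P.support ∧
      ∀ j ∈ P.support, T.dist r a ≤ T.dist r j → j ∈ X := by
  classical
  obtain ⟨p, hp, hpl⟩ := hT.1.exists_path_of_dist r a
  -- A shortest path to `a` is continued by a path inside `X`; as `a` is nearest to the root, the
  -- two share only `a`.
  obtain ⟨q₀, hq₀⟩ := (hX.preconnected ⟨a, ha⟩ ⟨i, hi⟩).exists_isPath
  let q : T.Walk a i := q₀.map (SimpleGraph.Embedding.induce X).toHom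
  have hq : q.IsPath :=
    hq₀.map (f := (SimpleGraph.Embedding.induce (G := T) X).toHom) Subtype.val_injective
  have hqX : ∀ j ∈ q.support, j ∈ X := by
    intro j hj
    have hsupp : q.support = q₀.support.map Subtype.val := SimpleGraph.Walk.support_map _ _
    rw [hsupp, List.mem_map] at hj
    obtain ⟨⟨j', hj'⟩, -, rfl⟩ := hj
    exact hj'
  have hpa : ∀ j ∈ p.support, T.dist r a ≤ T.dist r j → j = a := by
    intro j hj hle
    by_contra hne
    have h1 := SimpleGraph.dist_le (p.takeUntil j hj)
    have h2 := SimpleGraph.Walk.length_takeUntil_lt_length hj hne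
    omega
  refine ⟨p.append q, ?_, by simp, ?_⟩
  · rw [SimpleGraph.Walk.isPath_def, SimpleGraph.Walk.support_append, List.nodup_append']
    refine ⟨hp.support_nodup, hq.support_nodup.tail, ?_⟩
    intro j hj hj'
    have hja := hpa j hj (hmin j (hqX j (List.mem_of_mem_tail hj')))
    subst hja
    have hnd : (j :: q.support.tail).Nodup := by
      rw [q.cons_tail_support]
      exact hq.support_nodup
    exact (List.nodup_cons.1 hnd).1 hj'
  · intro j hj hle
    rcases (SimpleGraph.Walk.mem_support_append_iff _ _).1 hj with hj | hj
    · exact hpa j hj hle ▸ ha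
    · exact hqX j hj

/-- A graph of treewidth at most `t` has an elimination order of width `t`. -/
theorem HasTreewidth.nonempty_eliminationOrder {n t : ℕ} {G : SimpleGraph (Fin n)}
    (h : HasTreewidth G t) : Nonempty (EliminationOrder G t) := by
  classical
  obtain ⟨ι, _, T, bag, hT, hcard, hedge, hconn⟩ := h
  obtain ⟨r⟩ := hT.1.nonempty
  have htop : ∀ x, ∃ a, x ∈ bag a ∧ ∀ j, x ∈ bag j → T.dist r a ≤ T.dist r j := by
    intro x
    obtain ⟨⟨i, hi⟩⟩ := (hconn x).nonempty
    obtain ⟨a, ha, hmin⟩ := Set.exists_min_image {i | x ∈ bag i} (T.dist r) (Set.toFinite _) ⟨i, hi⟩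
    exact ⟨a, ha, hmin⟩
  choose top htop hmin using htop
  -- The unique path from the root to the common node `i` passes both tops, and from the top of `x`
  -- on all its bags contain `x`.
  have key : ∀ x y i, x ∈ bag i → y ∈ bag i → T.dist r (top x) ≤ T.dist r (top y) →
      x ∈ bag (top y) := by
    intro x y i hx hy hle
    obtain ⟨P, hP, -, hPX⟩ := exists_path_through_top hT r (hconn x) (htop x) hx (hmin x)
    obtain ⟨P', hP', hPY, -⟩ := exists_path_through_top hT r (hconn y) (htop y) hy (hmin y)
    have : P = P' := (hT.existsUnique_path r i).unique hP hP'
    subst this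
    exact hPX _ hPY hle
  -- Lexicographic order: depth of the top node, then the vertex number, which is below `n`.
  let rank : Fin n → ℕ := fun v => T.dist r (top v) * n + v
  have hrank : ∀ x y, rank x < rank y → T.dist r (top x) ≤ T.dist r (top y) := by
    intro x y hxy
    by_contra! hlt
    have h1 : (T.dist r (top y) + 1) * n ≤ T.dist r (top x) * n := Nat.mul_le_mul_right _ hlt
    have h2 := y.2
    simp only [rank] at hxy
    rw [add_mul, one_mul] at h1
    omega
  have hinj : ∀ x y, rank x = rank y → x = y := by
    intro x y hxy
    have h1 := congrArg (· % n) hxy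
    simp only [rank, Nat.mul_add_mod_of_lt x.2, Nat.mul_add_mod_of_lt y.2] at h1
    exact Fin.ext h1
  refine ⟨⟨rank, fun v => (bag (top v)).filter fun x => rank x < rank v,
    fun x y => hinj x y, ?_, ?_, ?_, ?_⟩⟩
  · intro v x hx
    exact (Finset.mem_filter.1 hx).2
  · intro u v huv
    obtain ⟨i, hu, hv⟩ := hedge u v huv
    simp only [Finset.mem_filter]
    rcases lt_trichotomy (rank u) (rank v) with hlt | heq | hlt
    · exact .inl ⟨key u v i hu hv (hrank _ _ hlt), hlt⟩
    · exact absurd (hinj _ _ heq) huv.ne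
    · exact .inr ⟨key v u i hv hu (hrank _ _ hlt), hlt⟩
  · intro v x y hx hy hlt
    simp only [Finset.mem_filter] at hx hy ⊢
    exact ⟨key y x _ hy.1 hx.1 (hrank _ _ hlt), hlt⟩
  · intro v
    have hsub : ((bag (top v)).filter fun x => rank x < rank v) ⊆ (bag (top v)).erase v := by
      intro x hx
      simp only [Finset.mem_filter] at hx
      exact Finset.mem_erase.2 ⟨fun h => by simp [h] at hx, hx.1⟩
    have h1 := Finset.card_le_card hsub
    rw [Finset.card_erase_of_mem (htop v)] at h1
    have h2 := hcard (top v)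
    omega

/-- A graph with an elimination order of width `t` has at most `t` edges per vertex. -/
theorem EliminationOrder.ncard_edgeSet_le {n t : ℕ} {G : SimpleGraph (Fin n)}
    (E : EliminationOrder G t) : G.edgeSet.ncard ≤ t * n := by
  classical
  have hsub : G.edgeSet ⊆
      ((Finset.univ.biUnion fun v => (E.up v).image fun x => s(x, v) : Finset (Sym2 (Fin n))) :
        Set (Sym2 (Fin n))) := by
    intro e
    induction e using Sym2.ind with
    | _ u v =>
      intro huv
      simp only [Finset.coe_biUnion, Set.mem_iUnion, Finset.mem_coe, Finset.mem_image,
        Finset.mem_univ]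
      rcases E.mem_up huv with h | h
      · exact ⟨v, trivial, u, h, rfl⟩
      · exact ⟨u, trivial, v, h, Sym2.eq_swap⟩
  refine (Set.ncard_le_ncard hsub (Finset.finite_toSet _)).trans ?_
  rw [Set.ncard_coe_finset]
  refine Finset.card_biUnion_le.trans ?_
  calc ∑ v, ((E.up v).image fun x => s(x, v)).card ≤ ∑ _v : Fin n, t :=
        Finset.sum_le_sum fun v _ => Finset.card_image_le.trans (E.card_up v)
    _ = t * n := by simp [mul_comm]

/-! ### Cutting a rooted forest into pieces -/

section Forest

variable {V : Type} {rank : V → ℕ} {parent : V → Option V}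

/-- Bottom-up recursion on a rooted forest. -/
theorem exists_bottom_up [Finite V] [DecidableEq V] {β : Type}
    (hp : ∀ c v, parent c = some v → rank v < rank c) (F : V → (V → β) → β) (b : β) :
    ∃ g : V → β, ∀ v, g v = F v fun c => if parent c = some v then g c else b := by
  cases nonempty_fintype V
  have wf : WellFounded fun c v : V => rank v < rank c := by
    refine Subrelation.wf ?_ (measure fun v => Finset.univ.sup rank - rank v).wf
    intro c v h
    have h1 : rank c ≤ Finset.univ.sup rank := Finset.le_sup (Finset.mem_univ c)
    change Finset.univ.sup rank - rank c < Finset.univ.sup rank - rank v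
    omega
  refine ⟨wf.fix fun v ih => F v fun c => if h : parent c = some v then ih c (hp c v h) else b, ?_⟩
  intro v
  rw [wf.fix_eq]
  simp only [dite_eq_ite]

/-- The root of the piece of a vertex, if a rooted forest is cut at the vertices of `Q`. -/
theorem exists_piece_root [DecidableEq V]
    (hp : ∀ c v, parent c = some v → rank v < rank c) (Q : Finset V) :
    ∃ root : V → V, (∀ v, parent v = none → root v = v) ∧
      ∀ v w, parent v = some w → root v = if w ∈ Q then v else root w := by
  have wf : WellFounded fun v c : V => rank v < rank c := (measure rank).wf
  let root : V → V := wf.fix fun v ih =>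
    match h : parent v with
    | none => v
    | some w => if w ∈ Q then v else ih w (hp v w h)
  refine ⟨root, ?_, ?_⟩
  · intro v hv
    simp only [root]
    rw [wf.fix_eq]
    split
    · rfl
    · simp_all
  · intro v w hv
    simp only [root]
    rw [wf.fix_eq]
    split
    · simp_all
    · rename_i w' h
      obtain rfl : w' = w := by simpa [h] using hv
      rfl

/-- A vertex has at most one parent, so the double sum counts it at most once. This makes sums over
a forest telescope. -/
theorem sum_children [DecidableEq V] (parent : V → Option V) (A C : Finset V) (g : V → ℕ) :
    ∑ v ∈ C, ∑ c ∈ A, (if parent c = some v then g c else 0) =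
      ∑ c ∈ A, if ∃ v ∈ C, parent c = some v then g c else 0 := by
  rw [Finset.sum_comm]
  refine Finset.sum_congr rfl fun c _ => ?_
  cases h : parent c with
  | none => simp
  | some w => simp [Finset.sum_ite_eq]

theorem sum_children_le [DecidableEq V] (parent : V → Option V) (A C : Finset V) (g : V → ℕ) :
    ∑ v ∈ C, ∑ c ∈ A, (if parent c = some v then g c else 0) ≤ ∑ c ∈ A, g c := by
  rw [sum_children]
  exact Finset.sum_le_sum fun c _ => by split <;> simp

theorem le_sum_children [DecidableEq V] (parent : V → Option V) {A C D : Finset V} (g : V → ℕ)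
    (hDA : D ⊆ A) (hD : ∀ c ∈ D, ∃ v ∈ C, parent c = some v) :
    ∑ c ∈ D, g c ≤ ∑ v ∈ C, ∑ c ∈ A, (if parent c = some v then g c else 0) := by
  rw [sum_children]
  refine le_trans (le_of_eq ?_) (Finset.sum_le_sum_of_subset hDA)
  exact Finset.sum_congr rfl fun c hc => by rw [if_pos (hD c hc)]

/-- A rooted forest has a set `Q` of at most `2 |A| / m` vertices such that all pieces of the forest
without `Q` have less than `m` vertices and at most one vertex of `Q` below them. -/
theorem exists_forest_cut [Finite V] [DecidableEq V]
    (hp : ∀ c v, parent c = some v → rank v < rank c) {A : Finset V}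
    (hA : ∀ c ∈ A, ∀ v, parent c = some v → v ∈ A) {m : ℕ} (hm : 1 ≤ m) :
    ∃ Q ⊆ A, ∃ root : V → V, m * Q.card ≤ 2 * A.card ∧
      (∀ v, parent v = none → root v = v) ∧
      (∀ v w, parent v = some w → root v = if w ∈ Q then v else root w) ∧
      (∀ r, ((A \ Q).filter fun v => root v = r).card < m) ∧
      ∀ r, (Q.filter fun q => ∃ w ∈ A \ Q, parent q = some w ∧ root w = r).card ≤ 1 := by
  classical
  -- What `v` reports to its parent: the number of vertices in the part of its piece at or below
  -- `v`, and the number of cut vertices hanging from that part. A vertex is cut when the piece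
  -- would reach `m` vertices or two cut vertices would hang from it; it then reports only itself as
  -- cut. The default `(0, 0)` is neutral in the sums.
  obtain ⟨g, hg⟩ := exists_bottom_up (parent := parent) hp (β := ℕ × ℕ)
    (fun _ h => if m ≤ 1 + ∑ c ∈ A, (h c).1 ∨ 2 ≤ ∑ c ∈ A, (h c).2 then (0, 1)
      else (1 + ∑ c ∈ A, (h c).1, ∑ c ∈ A, (h c).2)) (0, 0)
  let s : V → ℕ := fun v => ∑ c ∈ A, if parent c = some v then (g c).1 else 0
  let k : V → ℕ := fun v => ∑ c ∈ A, if parent c = some v then (g c).2 else 0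
  have hg' : ∀ v, g v = if m ≤ 1 + s v ∨ 2 ≤ k v then (0, 1) else (1 + s v, k v) := by
    intro v
    rw [hg v]
    simp only [s, k, apply_ite Prod.fst, apply_ite Prod.snd]
  let Q := A.filter fun v => m ≤ 1 + s v ∨ 2 ≤ k v
  have hQ : ∀ v ∈ Q, g v = (0, 1) := fun v hv => by
    rw [hg' v, if_pos (Finset.mem_filter.1 hv).2]
  have hnQ : ∀ v ∈ A \ Q, (1 + s v < m ∧ k v ≤ 1) ∧ g v = (1 + s v, k v) := fun v hv => by
    have h : ¬ (m ≤ 1 + s v ∨ 2 ≤ k v) := fun h =>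
      (Finset.mem_sdiff.1 hv).2 (Finset.mem_filter.2 ⟨(Finset.mem_sdiff.1 hv).1, h⟩)
    refine ⟨by omega, ?_⟩
    rw [hg' v, if_neg h]
  obtain ⟨root, hr0, hr1⟩ := exists_piece_root (parent := parent) hp Q
  have hroot : ∀ N v, rank v ≤ N → v ∈ A \ Q → root v ∈ A \ Q ∧ root (root v) = root v := by
    intro N
    induction N with
    | zero =>
      intro v hN hv
      cases h : parent v with
      | none => simp [hr0 v h, hv]
      | some w =>
        have := hp v w h
        omega
    | succ N ih =>
      intro v hN hv
      cases h : parent v with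
      | none => simp [hr0 v h, hv]
      | some w =>
        have hw := hp v w h
        by_cases hwQ : w ∈ Q
        · have : root v = v := by rw [hr1 v w h, if_pos hwQ]
          simp [this, hv]
        · have : root v = root w := by rw [hr1 v w h, if_neg hwQ]
          rw [this]
          exact ih w (by omega)
            (Finset.mem_sdiff.2 ⟨hA v (Finset.mem_sdiff.1 hv).1 w h, hwQ⟩)
  have hpar : ∀ r, ∀ c ∈ ((A \ Q).filter fun v => root v = r).erase r,
      ∃ v ∈ (A \ Q).filter fun v => root v = r, parent c = some v := by
    intro r c hc
    simp only [Finset.mem_erase, Finset.mem_filter] at hc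
    cases h : parent c with
    | none => exact absurd ((hr0 c h).symm.trans hc.2.2) hc.1
    | some w =>
      have h1 := hr1 c w h
      by_cases hwQ : w ∈ Q
      · rw [if_pos hwQ] at h1
        exact absurd (h1.symm.trans hc.2.2) hc.1
      · rw [if_neg hwQ] at h1
        refine ⟨w, Finset.mem_filter.2 ⟨Finset.mem_sdiff.2
          ⟨hA c (Finset.mem_sdiff.1 hc.2.1).1 w h, hwQ⟩, h1.symm.trans hc.2.2⟩, rfl⟩
  have hmemC : ∀ r, ∀ v ∈ (A \ Q).filter (fun v => root v = r),
      r ∈ (A \ Q).filter fun v => root v = r := by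
    intro r v hv
    rw [Finset.mem_filter] at hv ⊢
    have := hroot _ v le_rfl hv.1
    rw [hv.2] at this
    exact this
  have hsubA : ∀ r, ((A \ Q).filter fun v => root v = r) ⊆ A := fun r =>
    (Finset.filter_subset _ _).trans Finset.sdiff_subset
  refine ⟨Q, Finset.filter_subset _ _, root, ?_, hr0, hr1, ?_, ?_⟩
  -- Charging: every vertex brings 2 units. An uncut part passes 2 units per vertex and `m` per
  -- hanging cut vertex upwards; a cut vertex keeps `m` and passes `m` on. In the sum the transfers
  -- cancel.
  · have hloc : ∀ v ∈ A, m * (if v ∈ Q then 1 else 0) + m * (g v).2 + 2 * (g v).1 ≤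
        2 + 2 * s v + m * k v := by
      intro v hv
      by_cases hvQ : v ∈ Q
      · rw [if_pos hvQ, hQ v hvQ]
        rcases (Finset.mem_filter.1 hvQ).2 with h | h
        · have := Nat.zero_le (m * k v)
          simp only
          omega
        · have := Nat.mul_le_mul_left m h
          simp only
          omega
      · rw [if_neg hvQ, (hnQ v (Finset.mem_sdiff.2 ⟨hv, hvQ⟩)).2]
        simp only
        omega
    have hsum := Finset.sum_le_sum hloc
    simp only [Finset.sum_add_distrib, ← Finset.mul_sum, Finset.sum_const, smul_eq_mul] at hsum
    have h1 : ∑ v ∈ A, s v ≤ ∑ v ∈ A, (g v).1 := sum_children_le parent A A _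
    have h2 : ∑ v ∈ A, k v ≤ ∑ v ∈ A, (g v).2 := sum_children_le parent A A _
    have h3 : ∑ v ∈ A, (if v ∈ Q then 1 else 0) = Q.card := by
      rw [Finset.sum_boole, Finset.filter_mem_eq_inter,
        Finset.inter_eq_right.2 (Finset.filter_subset _ _)]
      rfl
    rw [h3] at hsum
    have h4 := Nat.mul_le_mul_left m h2
    omega
  · intro r
    rcases Finset.eq_empty_or_nonempty ((A \ Q).filter fun v => root v = r) with h0 | ⟨v, hv⟩
    · rw [h0, Finset.card_empty]
      exact hm
    · have hr := hmemC r v hv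
      -- All vertices of the piece except `r` are children of vertices of the piece, so the reports
      -- telescope to size at most `1 + s r`.
      have h1 := le_sum_children parent (A := A) (fun c => (g c).1)
        ((Finset.erase_subset r _).trans (hsubA r)) (hpar r)
      have h2 : ∑ c ∈ (A \ Q).filter (fun v => root v = r), (g c).1 =
          ∑ c ∈ (A \ Q).filter (fun v => root v = r), (1 + s c) :=
        Finset.sum_congr rfl fun c hc => by rw [(hnQ c (Finset.mem_filter.1 hc).1).2]
      rw [← Finset.add_sum_erase _ _ hr, Finset.sum_add_distrib, Finset.sum_const, smul_eq_mul,
        mul_one, (hnQ r (Finset.mem_filter.1 hr).1).2] at h2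
      have h3 := (hnQ r (Finset.mem_filter.1 hr).1).1.1
      simp only [s] at h1 h2 h3
      omega
  · intro r
    rcases Finset.eq_empty_or_nonempty
      (Q.filter fun q => ∃ w ∈ A \ Q, parent q = some w ∧ root w = r) with h0 | ⟨q, hq⟩
    · rw [h0, Finset.card_empty]
      exact zero_le_one
    · obtain ⟨w, hw, -, hwr⟩ := (Finset.mem_filter.1 hq).2
      have hr := hmemC r w (Finset.mem_filter.2 ⟨hw, hwr⟩)
      have hdisj : Disjoint (Q.filter fun q => ∃ w ∈ A \ Q, parent q = some w ∧ root w = r)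
          (((A \ Q).filter fun v => root v = r).erase r) := by
        rw [Finset.disjoint_left]
        intro x hx hx'
        exact (Finset.mem_sdiff.1 (Finset.mem_filter.1 (Finset.mem_of_mem_erase hx')).1).2
          (Finset.mem_filter.1 hx).1
      -- The same telescoping for the second component: each hanging vertex of `Q` reports 1, so
      -- there are at most `k r` of them.
      have h1 := le_sum_children parent (A := A) (C := (A \ Q).filter fun v => root v = r)
        (D := (Q.filter fun q => ∃ w ∈ A \ Q, parent q = some w ∧ root w = r) ∪
          ((A \ Q).filter fun v => root v = r).erase r) (fun c => (g c).2)
        (Finset.union_subset ((Finset.filter_subset _ _).trans (Finset.filter_subset _ _))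
          ((Finset.erase_subset r _).trans (hsubA r))) (by
          intro c hc
          rcases Finset.mem_union.1 hc with hc | hc
          · obtain ⟨w, hw, h, hwr⟩ := (Finset.mem_filter.1 hc).2
            exact ⟨w, Finset.mem_filter.2 ⟨hw, hwr⟩, h⟩
          · exact hpar r c hc)
      rw [Finset.sum_union hdisj, Finset.sum_congr rfl (fun c hc => by
        rw [hQ c (Finset.mem_filter.1 hc).1] : ∀ c ∈ Q.filter fun q => ∃ w ∈ A \ Q,
          parent q = some w ∧ root w = r, (g c).2 = 1), Finset.sum_const, smul_eq_mul,
        mul_one] at h1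
      have h2 : ∑ c ∈ (A \ Q).filter (fun v => root v = r), (g c).2 =
          ∑ c ∈ (A \ Q).filter (fun v => root v = r), k c :=
        Finset.sum_congr rfl fun c hc => by rw [(hnQ c (Finset.mem_filter.1 hc).1).2]
      rw [← Finset.add_sum_erase _ _ hr, (hnQ r (Finset.mem_filter.1 hr).1).2] at h2
      have h3 := (hnQ r (Finset.mem_filter.1 hr).1).1.2
      simp only [k] at h1 h2 h3
      omega

end Forest

/-! ### Separators from elimination forests. -/

namespace EliminationOrder

variable {V : Type} {G : SimpleGraph V} {t : ℕ}

/-- The parent of a vertex in the elimination forest of `A` is its upper neighbour of greatest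
rank. -/
theorem exists_parent [DecidableEq V] (E : EliminationOrder G t) (A : Finset V) :
    ∃ parent : V → Option V, (∀ v, parent v = none → E.up v ∩ A = ∅) ∧
      ∀ v w, parent v = some w →
        w ∈ E.up v ∩ A ∧ ∀ x ∈ E.up v ∩ A, x = w ∨ x ∈ E.up w ∩ A := by
  have h : ∀ v, ∃ o : Option V, (o = none → E.up v ∩ A = ∅) ∧
      ∀ w, o = some w → w ∈ E.up v ∩ A ∧ ∀ x ∈ E.up v ∩ A, x = w ∨ x ∈ E.up w ∩ A := by
    intro v
    rcases Finset.eq_empty_or_nonempty (E.up v ∩ A) with h0 | h0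
    · exact ⟨none, fun _ => h0, fun w hw => by simp at hw⟩
    -- By the clique property, the other upper neighbours of `v` are upper neighbours of the one of
    -- greatest rank.
    · obtain ⟨w, hw, hmax⟩ := Finset.exists_max_image _ E.rank h0
      refine ⟨some w, fun h => by simp at h, ?_⟩
      intro w' hw'
      obtain rfl : w = w' := by simpa using hw'
      refine ⟨hw, fun x hx => ?_⟩
      rcases (hmax x hx).lt_or_eq with hlt | heq
      · rw [Finset.mem_inter] at hw hx ⊢
        exact .inr ⟨E.clique hw.1 hx.1 hlt, hx.2⟩
      · exact .inl (E.rank_injective heq)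
  choose parent h0 h1 using h
  exact ⟨parent, h0, h1⟩

/-- A set `A` of vertices has a separator `S` of at most `2 (t + 1) |A| / m` vertices that splits
the rest of `A` into pieces of less than `m` vertices, each of which has at most `2 t` neighbours
in `S`. The function `root` names the pieces, and `bd` names their neighbours in `S`. -/
theorem exists_separator [Finite V] [DecidableEq V] (E : EliminationOrder G t) (A : Finset V)
    {m : ℕ} (hm : 1 ≤ m) :
    ∃ S ⊆ A, ∃ (root : V → V) (bd : V → Finset V), m * S.card ≤ 2 * (t + 1) * A.card ∧
      (∀ r, ((A \ S).filter fun v => root v = r).card < m) ∧ (∀ r, (bd r).card ≤ 2 * t) ∧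
      ∀ v ∈ A \ S, ∀ s ∈ A, G.Adj v s →
        (s ∈ S → s ∈ bd (root v)) ∧ (s ∉ S → root s = root v) := by
  classical
  obtain ⟨parent, hpn, hps⟩ := E.exists_parent A
  have hup : ∀ v x, x ∈ E.up v ∩ A → E.rank x < E.rank v := fun v x hx =>
    E.rank_lt (Finset.mem_inter.1 hx).1
  have hp : ∀ c v, parent c = some v → E.rank v < E.rank c := fun c v h => hup c v (hps c v h).1
  have hpA : ∀ c v, parent c = some v → v ∈ A := fun c v h => (Finset.mem_inter.1 (hps c v h).1).2
  obtain ⟨Q, hQA, root, hQm, -, hroot, hsize, hbelow⟩ :=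
    exists_forest_cut hp (A := A) (fun c _ => hpA c) hm
  -- An edge of `A` that passes over `q` in the forest has its upper end in `up q`, so `q` and its
  -- upper neighbours cut all such edges.
  let S := Q.biUnion fun q => insert q (E.up q ∩ A)
  let below : V → Finset V := fun r =>
    Q.filter fun q => ∃ w ∈ A \ Q, parent q = some w ∧ root w = r
  let bd : V → Finset V := fun r => (E.up r ∩ A) ∪ (below r).biUnion fun q => E.up q ∩ A
  have hcard : ∀ v, (E.up v ∩ A).card ≤ t := fun v =>
    (Finset.card_le_card Finset.inter_subset_left).trans (E.card_up v)
  have hQS : Q ⊆ S := fun q hq => Finset.mem_biUnion.2 ⟨q, hq, Finset.mem_insert_self _ _⟩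
  have hSA : S ⊆ A := Finset.biUnion_subset.2 fun q hq =>
    Finset.insert_subset (hQA hq) Finset.inter_subset_right
  have step : ∀ x s, s ∈ E.up x ∩ A → ∃ w, parent x = some w ∧ (s = w ∨ s ∈ E.up w ∩ A) := by
    intro x s hs
    cases h : parent x with
    | none =>
      rw [hpn x h] at hs
      exact absurd hs (Finset.notMem_empty s)
    | some w => exact ⟨w, rfl, (hps x w h).2 s hs⟩
  -- an upper neighbour of `x` in `A`
  have up1 : ∀ N x, E.rank x ≤ N → ∀ s ∈ E.up x ∩ A,
      s ∈ E.up (root x) ∩ A ∨ s ∉ Q ∧ root s = root x := by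
    intro N
    induction N with
    | zero =>
      intro x hN s hs
      have := hup x s hs
      omega
    | succ N ih =>
      intro x hN s hs
      obtain ⟨w, hw, hsw⟩ := step x s hs
      have hlt := hp x w hw
      by_cases hwQ : w ∈ Q
      · left
        rwa [hroot x w hw, if_pos hwQ]
      · rw [hroot x w hw, if_neg hwQ]
        rcases hsw with rfl | hsw
        · exact .inr ⟨hwQ, rfl⟩
        · exact ih w (by omega) s hsw
  -- If `s` or a vertex strictly between `s` and `v` in the forest were in `Q`, then `v` would be
  -- one of its upper neighbours and hence in `S`.
  have up2 : ∀ N s, E.rank s ≤ N → s ∈ A → ∀ v ∉ S, v ∈ E.up s ∩ A →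
      s ∉ Q ∧ root s = root v := by
    intro N
    induction N with
    | zero =>
      intro s hN _ v _ hvs
      have := hup s v hvs
      omega
    | succ N ih =>
      intro s hN hsA v hvS hvs
      refine ⟨fun hsQ => hvS (Finset.mem_biUnion.2 ⟨s, hsQ, Finset.mem_insert_of_mem hvs⟩), ?_⟩
      obtain ⟨w, hw, hvw⟩ := step s v hvs
      have hlt := hp s w hw
      rcases hvw with rfl | hvw
      · rw [hroot s v hw, if_neg fun h => hvS (hQS h)]
      · obtain ⟨hwQ, h⟩ := ih w (by omega) (hpA s w hw) v hvS hvw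
        rw [hroot s w hw, if_neg hwQ, h]
  have up3 : ∀ N x, E.rank x ≤ N → ∀ s ∉ Q, s ∈ E.up x ∩ A →
      root s = root x ∨ ∃ q ∈ Q, s ∈ E.up q ∩ A ∧ E.rank q < E.rank x := by
    intro N
    induction N with
    | zero =>
      intro x hN s _ hs
      have := hup x s hs
      omega
    | succ N ih =>
      intro x hN s hsQ hs
      obtain ⟨w, hw, hsw⟩ := step x s hs
      have hlt := hp x w hw
      by_cases hwQ : w ∈ Q
      · rcases hsw with rfl | hsw
        · exact absurd hwQ hsQ
        · exact .inr ⟨w, hwQ, hsw, hlt⟩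
      · rw [hroot x w hw, if_neg hwQ]
        rcases hsw with rfl | hsw
        · exact .inl rfl
        · rcases ih w (by omega) s hsQ hsw with h | ⟨q, hq, hsq, hlt'⟩
          · exact .inl h
          · exact .inr ⟨q, hq, hsq, hlt'.trans hlt⟩
  -- On the way up from `q` to `s`, the last vertex of `Q` has its parent in the piece of `s`, so it
  -- is the vertex below that piece. `up3` advances towards it.
  have up4 : ∀ N q, E.rank q ≤ N → q ∈ Q → ∀ s ∉ Q, s ∈ E.up q ∩ A → s ∈ bd (root s) := by
    intro N
    induction N with
    | zero =>
      intro q hN _ s _ hs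
      have := hup q s hs
      omega
    | succ N ih =>
      intro q hN hq s hsQ hs
      have hbd : ∀ w, parent q = some w → w ∉ Q → root s = root w → s ∈ bd (root s) :=
        fun w hw hwQ h => Finset.mem_union_right _ (Finset.mem_biUnion.2 ⟨q, Finset.mem_filter.2
          ⟨hq, w, Finset.mem_sdiff.2 ⟨hpA q w hw, hwQ⟩, hw, h.symm⟩, hs⟩)
      obtain ⟨w, hw, hsw⟩ := step q s hs
      have hlt := hp q w hw
      rcases hsw with rfl | hsw
      · exact hbd s hw hsQ rfl
      by_cases hwQ : w ∈ Q
      · exact ih w (by omega) hwQ s hsQ hsw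
      rcases up3 _ w le_rfl s hsQ hsw with h | ⟨q', hq', hsq', hlt'⟩
      · exact hbd w hw hwQ h
      · exact ih q' (by omega) hq' s hsQ hsq'
  refine ⟨S, hSA, root, bd, ?_, ?_, ?_, ?_⟩
  · have h1 : S.card ≤ Q.card * (t + 1) :=
      Finset.card_biUnion_le_card_mul _ _ _ fun q _ =>
        (Finset.card_insert_le _ _).trans (Nat.add_le_add_right (hcard q) 1)
    calc m * S.card ≤ m * (Q.card * (t + 1)) := Nat.mul_le_mul_left _ h1
      _ = m * Q.card * (t + 1) := by ring
      _ ≤ 2 * A.card * (t + 1) := Nat.mul_le_mul_right _ hQm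
      _ = 2 * (t + 1) * A.card := by ring
  · intro r
    refine lt_of_le_of_lt (Finset.card_le_card ?_) (hsize r)
    exact Finset.filter_subset_filter _ (Finset.sdiff_subset_sdiff subset_rfl hQS)
  · intro r
    have h1 : ((below r).biUnion fun q => E.up q ∩ A).card ≤ (below r).card * t :=
      Finset.card_biUnion_le_card_mul _ _ _ fun q _ => hcard q
    have h2 : (below r).card * t ≤ 1 * t := Nat.mul_le_mul_right _ (hbelow r)
    have h3 : (bd r).card ≤ _ := Finset.card_union_le _ _
    have h4 := hcard r
    omega
  · intro v hv s hs hadj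
    rw [Finset.mem_sdiff] at hv
    have hS : s ∉ Q → root s = root v → s ∈ S → s ∈ bd (root v) := by
      intro hsQ hr hsS
      obtain ⟨q, hq, hsq⟩ := Finset.mem_biUnion.1 hsS
      rcases Finset.mem_insert.1 hsq with rfl | hsq
      · exact absurd hq hsQ
      · exact hr ▸ up4 _ q le_rfl hq s hsQ hsq
    rcases E.mem_up hadj with h | h
    · obtain ⟨h1, h2⟩ := up2 _ s le_rfl hs v hv.2 (Finset.mem_inter.2 ⟨h, hv.1⟩)
      exact ⟨hS h1 h2, fun _ => h2⟩
    · have hsv := Finset.mem_inter.2 ⟨h, hs⟩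
      refine ⟨fun hsS => ?_, fun hsS => ((up2 _ v le_rfl hv.1 s hsS hsv).2).symm⟩
      rcases up1 _ v le_rfl s hsv with h1 | h1
      · exact Finset.mem_union_left _ h1
      · exact hS h1.1 h1.2 hsS

end EliminationOrder

/-! ### The recursive choice of the hops. -/

/-- A walk in `A` either avoids the separator and stays in one piece, or it meets the separator
first in its start or in a neighbour of the piece of its start. -/
theorem avoids_or_splits {V : Type} {G : SimpleGraph V} [DecidableEq V] {A S : Finset V}
    {root : V → V} {bd : V → Finset V}
    (h : ∀ v ∈ A \ S, ∀ s ∈ A, G.Adj v s →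
      (s ∈ S → s ∈ bd (root v)) ∧ (s ∉ S → root s = root v))
    {u v : V} (p : G.Walk u v) (hp : ∀ x ∈ p.support, x ∈ A) :
    (∀ x ∈ p.support, x ∉ S ∧ root x = root u) ∨
      ∃ x ∈ S, x ∈ (if u ∈ S then {u} else bd (root u)) ∧
        ∃ (p₁ : G.Walk u x) (p₂ : G.Walk x v), p = p₁.append p₂ := by
  induction p with
  | @nil u =>
    by_cases hu : u ∈ S
    · exact .inr ⟨u, hu, by simp [hu], .nil, .nil, rfl⟩
    · left
      intro x hx
      obtain rfl : x = u := by simpa using hx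
      exact ⟨hu, rfl⟩
  | @cons u w v hadj q ih =>
    by_cases hu : u ∈ S
    · exact .inr ⟨u, hu, by simp [hu], .nil, .cons hadj q, rfl⟩
    have huA : u ∈ A := hp u (by simp)
    have hwA : w ∈ A := hp w (by simp)
    have huw := h u (Finset.mem_sdiff.2 ⟨huA, hu⟩) w hwA hadj
    rcases ih (fun x hx => hp x (by simp [hx])) with hq | ⟨x, hxS, hx, p₁, p₂, rfl⟩
    · left
      intro x hx
      rw [SimpleGraph.Walk.support_cons, List.mem_cons] at hx
      rcases hx with rfl | hx
      · exact ⟨hu, rfl⟩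
      · exact ⟨(hq x hx).1, (hq x hx).2.trans (huw.2 (hq w (by simp)).1)⟩
    · right
      refine ⟨x, hxS, ?_, .cons hadj p₁, p₂, rfl⟩
      rw [if_neg hu]
      by_cases hw : w ∈ S
      · rw [if_pos hw, Finset.mem_singleton] at hx
        exact hx ▸ huw.1 hw
      · rw [if_neg hw] at hx
        exact huw.2 hw ▸ hx

/-- The first/last-hop neighbours `N` and the middle hops `H` split all walks in `A`. -/
def SplitsWalks {V : Type} (G : SimpleGraph V) (A : Finset V) (N : V → Finset V)
    (H : Finset (Sym2 V)) : Prop :=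
  ∀ (u v : V) (p : G.Walk u v), (∀ x ∈ p.support, x ∈ A) →
    ∃ x ∈ N u, ∃ y ∈ N v, s(x, y) ∈ H ∧
      ∃ (p₁ : G.Walk u x) (p₂ : G.Walk x y) (p₃ : G.Walk y v), p = p₁.append (p₂.append p₃)

/-- Three hops suffice to follow any walk in a set of at most `t * 2 ^ 2 ^ k` vertices, with
`O(t k)` first/last-hop neighbours per vertex. -/
theorem EliminationOrder.exists_splitsWalks {V : Type} [Finite V] {G : SimpleGraph V} {t : ℕ}
    (E : EliminationOrder G t) (ht : 1 ≤ t) (k : ℕ) :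
    ∀ A : Finset V, A.card ≤ t * 2 ^ 2 ^ k → ∃ (N : V → Finset V) (H : Finset (Sym2 V)),
      (∀ w, (N w).card ≤ 2 * t * (k + 1)) ∧ H.card ≤ 16 * t * A.card * (k + 1) ∧
      SplitsWalks G A N H := by
  classical
  induction k with
  | zero =>
    intro A hA
    -- At most `2 * t` vertices: the first hop goes straight to the target, and the other two are
    -- loops.
    refine ⟨fun _ => A, A.image fun v => s(v, v), fun w => ?_, ?_, ?_⟩
    · simp only [pow_zero, pow_one] at hA ⊢
      omega
    · refine Finset.card_image_le.trans ?_
      rw [zero_add, mul_one]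
      exact Nat.le_mul_of_pos_left _ (by omega)
    · intro u v p hp
      exact ⟨v, hp v (by simp), v, hp v (by simp), Finset.mem_image_of_mem _ (hp v (by simp)),
        p, .nil, .nil, by simp⟩
  | succ k ih =>
    intro A hA
    -- This balances the sizes of pieces and separator; the `+ 1` ensures `t * A.card < m ^ 2`.
    let m := Nat.sqrt (t * A.card) + 1
    obtain ⟨S, hSA, root, bd, hS, hsize, hbd, hadj⟩ :=
      E.exists_separator A (m := m) (Nat.le_add_left 1 _)
    let piece : V → Finset V := fun r => (A \ S).filter fun v => root v = r
    have hpiece : ∀ r, (piece r).card ≤ t * 2 ^ 2 ^ k := by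
      intro r
      have h1 : (piece r).card ≤ Nat.sqrt (t * A.card) := Nat.lt_succ_iff.1 (hsize r)
      have h2 : (piece r).card ^ 2 ≤ (t * 2 ^ 2 ^ k) ^ 2 :=
        calc (piece r).card ^ 2 ≤ Nat.sqrt (t * A.card) ^ 2 := Nat.pow_le_pow_left h1 2
          _ ≤ t * A.card := Nat.sqrt_le' _
          _ ≤ t * (t * 2 ^ 2 ^ (k + 1)) := Nat.mul_le_mul_left _ hA
          _ = (t * 2 ^ 2 ^ k) ^ 2 := by
            rw [mul_pow, ← pow_mul, ← pow_succ]
            ring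
      exact (Nat.pow_le_pow_iff_left two_ne_zero).1 h2
    choose N H hN hH hsplit using fun r => ih (piece r) (hpiece r)
    -- The 16 is the square of the 4 in `2 * (t + 1) ≤ 4 * t`.
    have hSsq : S.card ^ 2 ≤ 16 * t * A.card := by
      have h1 : t * A.card ≤ m ^ 2 := (Nat.lt_succ_sqrt' _).le
      have h2 : m * S.card ≤ 4 * (t * A.card) :=
        hS.trans (by nlinarith [Nat.mul_le_mul_right A.card ht])
      have h3 : m ^ 2 * S.card ^ 2 ≤ m ^ 2 * (16 * t * A.card) :=
        calc m ^ 2 * S.card ^ 2 = (m * S.card) ^ 2 := by ring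
          _ ≤ (4 * (t * A.card)) ^ 2 := Nat.pow_le_pow_left h2 2
          _ = t * A.card * (16 * t * A.card) := by ring
          _ ≤ m ^ 2 * (16 * t * A.card) := Nat.mul_le_mul_right _ h1
      exact Nat.le_of_mul_le_mul_left h3 (by positivity)
    let N₀ : V → Finset V := fun u => if u ∈ S then {u} else bd (root u)
    have hN₀ : ∀ u, (N₀ u).card ≤ 2 * t := by
      intro u
      simp only [N₀]
      split
      · simp only [Finset.card_singleton]
        omega
      · exact hbd _
    -- `sym2` includes the loops, needed when both splitting vertices coincide.
    refine ⟨fun u => N₀ u ∪ N (root u) u, S.sym2 ∪ (A.image root).biUnion H, ?_, ?_, ?_⟩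
    · intro w
      calc _ ≤ (N₀ w).card + (N (root w) w).card := Finset.card_union_le _ _
        _ ≤ 2 * t + 2 * t * (k + 1) := Nat.add_le_add (hN₀ w) (hN (root w) w)
        _ = 2 * t * (k + 1 + 1) := by ring
    · have h1 : S.sym2.card ≤ S.card ^ 2 := by
        rw [Finset.card_sym2, Nat.choose_two_right, Nat.add_sub_cancel]
        refine Nat.div_le_of_le_mul ?_
        nlinarith [Nat.le_mul_self S.card]
      have h2 : ((A.image root).biUnion H).card ≤ 16 * t * A.card * (k + 1) :=
        calc _ ≤ ∑ r ∈ A.image root, (H r).card := Finset.card_biUnion_le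
          -- The pieces are enlarged to the fibres of `root`, which partition `A`.
          _ ≤ ∑ r ∈ A.image root, 16 * t * (A.filter fun v => root v = r).card * (k + 1) := by
            refine Finset.sum_le_sum fun r _ => (hH r).trans ?_
            gcongr
            exact Finset.filter_subset_filter _ Finset.sdiff_subset
          _ = 16 * t * A.card * (k + 1) := by
            rw [← Finset.sum_mul, ← Finset.mul_sum, ← Finset.card_eq_sum_card_image]
      calc _ ≤ _ := Finset.card_union_le _ _
        _ ≤ 16 * t * A.card + 16 * t * A.card * (k + 1) := by omega
        _ = 16 * t * A.card * (k + 1 + 1) := by ring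
    · intro u v p hp
      rcases avoids_or_splits hadj p hp with h | ⟨x, hxS, hx, p₁, p₂, rfl⟩
      · obtain ⟨x, hx, y, hy, hxy, h'⟩ := hsplit (root u) u v p fun x hx => Finset.mem_filter.2
          ⟨Finset.mem_sdiff.2 ⟨hp x hx, (h x hx).1⟩, (h x hx).2⟩
        refine ⟨x, Finset.mem_union_right _ hx, y, Finset.mem_union_right _ ?_,
          Finset.mem_union_right _ (Finset.mem_biUnion.2 ⟨root u, Finset.mem_image_of_mem _
            (hp u (by simp)), hxy⟩), h'⟩
        rwa [(h v (by simp)).2]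
      -- Read from its other end, the rest of the walk cannot avoid `S`, since it ends in `x`.
      · rcases avoids_or_splits hadj p₂.reverse (fun x hx => hp x (by
          rw [SimpleGraph.Walk.mem_support_append_iff]
          exact .inr (by simpa using hx))) with h | ⟨y, hyS, hy, q₁, q₂, hq⟩
        · exact absurd hxS (h x (by simp)).1
        · refine ⟨x, Finset.mem_union_left _ hx, y, Finset.mem_union_left _ hy,
            Finset.mem_union_left _ (Finset.mk_mem_sym2_iff.2 ⟨hxS, hyS⟩),
            p₁, q₂.reverse, q₁.reverse, ?_⟩
          rw [← SimpleGraph.Walk.reverse_append, ← hq, SimpleGraph.Walk.reverse_reverse]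

/-! ### Walk lengths and distances -/

section WalkLength

variable {V : Type} {G : SimpleGraph V} {l : V → V → ℝ≥0∞}

@[simp] theorem walkLength_nil {u : V} : walkLength l (SimpleGraph.Walk.nil : G.Walk u u) = 0 := by
  simp [walkLength]

@[simp] theorem walkLength_cons {u v w : V} (h : G.Adj u v) (p : G.Walk v w) :
    walkLength l (.cons h p) = l u v + walkLength l p := by
  simp [walkLength]

@[simp] theorem walkLength_append {u v w : V} (p : G.Walk u v) (q : G.Walk v w) :
    walkLength l (p.append q) = walkLength l p + walkLength l q := by
  simp [walkLength]

theorem walkLength_reverse (hl : ∀ u v, l u v = l v u) {u v : V} (p : G.Walk u v) :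
    walkLength l p.reverse = walkLength l p := by
  induction p with
  | nil => simp
  | cons h p ih => simp [ih, hl, add_comm]

theorem walkLength_bypass_le [DecidableEq V] {u v : V} (p : G.Walk u v) :
    walkLength l p.bypass ≤ walkLength l p :=
  (p.darts_bypass_sublist_darts.map _).sum_le_sum fun _ _ => zero_le

theorem exists_nat_walkLength {M : ℕ} (hl : ∀ u v, G.Adj u v → ∃ k : ℕ, k ≤ M ∧ l u v = k)
    {u v : V} (p : G.Walk u v) : ∃ k : ℕ, k ≤ p.length * M ∧ walkLength l p = k := by
  induction p with
  | nil => exact ⟨0, by simp⟩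
  | cons h p ih =>
    obtain ⟨a, ha, ha'⟩ := hl _ _ h
    obtain ⟨b, hb, hb'⟩ := ih
    refine ⟨a + b, ?_, by simp [ha', hb']⟩
    rw [SimpleGraph.Walk.length_cons, add_mul, one_mul]
    omega

end WalkLength

namespace WeightedGraph

variable {V : Type} (G : WeightedGraph V)

theorem dist_le_walkLength {u v : V} (p : G.graph.Walk u v) :
    G.dist u v ≤ walkLength (fun x y => (G.weight x y : ℝ≥0∞)) p :=
  iInf_le _ p

theorem dist_self (u : V) : G.dist u u = 0 :=
  le_antisymm ((G.dist_le_walkLength .nil).trans_eq walkLength_nil) zero_le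

theorem dist_le_weight {u v : V} (h : G.graph.Adj u v) : G.dist u v ≤ G.weight u v :=
  (G.dist_le_walkLength (.cons h .nil)).trans_eq (by simp)

theorem dist_comm (u v : V) : G.dist u v = G.dist v u := by
  have key : ∀ u v, G.dist u v ≤ G.dist v u := fun u v => le_iInf fun p => by
    rw [← walkLength_reverse (fun x y => by rw [G.weight_symm]) p]
    exact G.dist_le_walkLength _
  exact le_antisymm (key u v) (key v u)

theorem dist_triangle (u v w : V) : G.dist u w ≤ G.dist u v + G.dist v w := by
  refine ENNReal.le_iInf_add_iInf fun p q => ?_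
  rw [← walkLength_append]
  exact G.dist_le_walkLength _

/-- A finite distance is attained by a path. -/
theorem exists_isPath_walkLength_eq_dist [Finite V] {u v : V} (h : G.dist u v ≠ ⊤) :
    ∃ p : G.graph.Walk u v, p.IsPath ∧
      walkLength (fun x y => (G.weight x y : ℝ≥0∞)) p = G.dist u v := by
  classical
  cases nonempty_fintype V
  have hne : Nonempty (G.graph.Path u v) := by
    by_contra hempty
    apply h
    simp only [dist, iInf_eq_top]
    exact fun p => (hempty ⟨⟨p.bypass, p.bypass_isPath⟩⟩).elim
  obtain ⟨p, hp⟩ := Finite.exists_min fun p : G.graph.Path u v =>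
    walkLength (fun x y => (G.weight x y : ℝ≥0∞)) p.1
  refine ⟨p.1, p.2, le_antisymm (le_iInf fun q => ?_) (G.dist_le_walkLength _)⟩
  exact (hp ⟨q.bypass, q.bypass_isPath⟩).trans (walkLength_bypass_le q)

/-- A finite distance in a graph with integer weights up to `M` is an integer less than `n * M`. -/
theorem exists_nat_dist {n : ℕ} {G : WeightedGraph (Fin n)} {M : ℕ}
    (hM : 1 ≤ M) (hw : ∀ u v, G.graph.Adj u v → ∃ k : ℕ, k ≤ M ∧ G.weight u v = k) {u v : Fin n}
    (h : G.dist u v ≠ ⊤) : ∃ k : ℕ, k < n * M ∧ G.dist u v = k := by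
  obtain ⟨p, hp, hpd⟩ := G.exists_isPath_walkLength_eq_dist h
  obtain ⟨k, hk, hk'⟩ := exists_nat_walkLength (l := fun x y => (G.weight x y : ℝ≥0∞)) (M := M)
    (fun x y hxy => (hw x y hxy).imp fun k hk => ⟨hk.1, by simp [hk.2]⟩) p
  refine ⟨k, hk.trans_lt ?_, hpd.symm.trans hk'⟩
  -- A path has fewer than `n` edges; `1 ≤ M` keeps the bound strict.
  have := hp.length_lt
  rw [Fintype.card_fin] at this
  exact Nat.mul_lt_mul_of_pos_right this hM

variable {G}

theorem dist_le_walkLength_augLength {H : Set (Sym2 V)} {u v : V} (p : (G.augGraph H).Walk u v) :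
    G.dist u v ≤ walkLength (G.augLength H) p := by
  induction p with
  | nil => simp [dist_self]
  | @cons u w v h p ih =>
    rw [walkLength_cons]
    refine (G.dist_triangle u w v).trans (add_le_add ?_ ih)
    unfold augLength
    split
    · exact le_rfl
    · rename_i hH
      rcases h with h | h
      · exact G.dist_le_weight h
      · exact absurd ((SimpleGraph.fromEdgeSet_adj _).1 h).1 hH

/-- A loop of `H` is no edge of `augGraph`; the empty walk replaces it. -/
theorem exists_hop {H : Set (Sym2 V)} {u v : V} (h : s(u, v) ∈ H) :
    ∃ p : (G.augGraph H).Walk u v, p.length ≤ 1 ∧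
      walkLength (G.augLength H) p ≤ G.dist u v := by
  by_cases huv : u = v
  · subst huv
    exact ⟨.nil, by simp, by simp⟩
  · have hadj : (G.augGraph H).Adj u v := .inr ((SimpleGraph.fromEdgeSet_adj _).2 ⟨h, huv⟩)
    exact ⟨.cons hadj .nil, by simp, by simp [augLength, h]⟩

theorem isHopset_three {H : Set (Sym2 V)} (hfin : ∀ u v, s(u, v) ∈ H → G.dist u v ≠ ⊤)
    (hcov : ∀ u v, G.dist u v ≠ ⊤ → ∃ x y, s(u, x) ∈ H ∧ s(x, y) ∈ H ∧ s(y, v) ∈ H ∧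
      G.dist u v = G.dist u x + G.dist x y + G.dist y v) :
    G.IsHopset 3 H := by
  refine ⟨hfin, fun u v => le_antisymm ?_ (le_iInf fun p => dist_le_walkLength_augLength p.1)⟩
  by_cases h : G.dist u v = ⊤
  · exact h ▸ le_top
  obtain ⟨x, y, hux, hxy, hyv, heq⟩ := hcov u v h
  obtain ⟨p, hp, hp'⟩ := exists_hop (G := G) hux
  obtain ⟨q, hq, hq'⟩ := exists_hop (G := G) hxy
  obtain ⟨r, hr, hr'⟩ := exists_hop (G := G) hyv
  have hlen : ((p.append q).append r).length ≤ 3 := by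
    rw [SimpleGraph.Walk.length_append, SimpleGraph.Walk.length_append]
    omega
  calc hopDist (G.augGraph H) (G.augLength H) 3 u v
      ≤ walkLength (G.augLength H) ((p.append q).append r) :=
        iInf_le (fun p : {p : (G.augGraph H).Walk u v // p.length ≤ 3} =>
          walkLength (G.augLength H) p.1) ⟨_, hlen⟩
    _ ≤ G.dist u v := by
      rw [walkLength_append, walkLength_append, heq]
      exact add_le_add (add_le_add hp' hq') hr'

end WeightedGraph

/-! ### Queries -/

@[simp] theorem Timed.val_bind {α β : Type} (x : Timed α) (f : α → Timed β) :
    (x >>= f).val = (f x.val).val := rfl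

@[simp] theorem Timed.time_bind {α β : Type} (x : Timed α) (f : α → Timed β) :
    (x >>= f).time = x.time + (f x.val).time := rfl

@[simp] theorem Timed.val_pure {α : Type} (a : α) : (pure a : Timed α).val = a := rfl

@[simp] theorem Timed.time_pure {α : Type} (a : α) : (pure a : Timed α).time = 0 := rfl

@[simp] theorem Timed.val_op {α : Type} (a : α) : (Timed.op a).val = a := rfl

@[simp] theorem Timed.time_op {α : Type} (a : α) : (Timed.op a).time = 1 := rfl

namespace Store

variable {n : ℕ} {S : Store n}

/-- One look-up, two additions and one comparison. -/
theorem relax_time_le (x : Fin n) (a : ℝ≥0) (y : Fin n) (b : ℝ≥0) (best : ℝ≥0∞) :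
    (S.relax x a y b best).time ≤ 4 := by
  unfold relax
  simp only [Timed.time_bind, Timed.val_op, Timed.time_op]
  split <;> simp

theorem scanLast_time_le (x : Fin n) (a : ℝ≥0) (l : List (Fin n × ℝ≥0)) (best : ℝ≥0∞) :
    (S.scanLast x a l best).time ≤ 5 * l.length + 1 := by
  induction l generalizing best with
  | nil => simp [scanLast]
  | cons e l ih =>
    have h1 := S.relax_time_le x a e.1 e.2 best
    have h2 := ih (S.relax x a e.1 e.2 best).val
    simp only [scanLast, Timed.time_bind, Timed.val_op, Timed.time_op, List.length_cons]
    omega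

/-- The 3 counts fetching the entry, fetching the list of `v`, and noticing the end of that list. -/
theorem scanFirst_time_le (v : Fin n) (l : List (Fin n × ℝ≥0)) (best : ℝ≥0∞) :
    (S.scanFirst v l best).time ≤ l.length * (5 * (S.hops v).length + 3) + 1 := by
  induction l generalizing best with
  | nil => simp [scanFirst]
  | cons e l ih =>
    have h1 := S.scanLast_time_le e.1 e.2 (S.hops v) best
    have h2 := ih (S.scanLast e.1 e.2 (S.hops v) best).val
    simp only [scanFirst, Timed.time_bind, Timed.val_op, Timed.time_op, List.length_cons]
    rw [add_mul, one_mul]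
    omega

theorem query_time_le (u v : Fin n) :
    (S.query u v).time ≤ (S.hops u).length * (5 * (S.hops v).length + 3) + 2 := by
  have h := S.scanFirst_time_le v (S.hops u) ⊤
  simp only [query, Timed.time_bind, Timed.val_op, Timed.time_op]
  omega

theorem relax_val_le_best (x : Fin n) (a : ℝ≥0) (y : Fin n) (b : ℝ≥0) (best : ℝ≥0∞) :
    (S.relax x a y b best).val ≤ best := by
  unfold relax
  simp only [Timed.val_bind, Timed.val_op]
  split <;> simp

theorem relax_val_le {x y : Fin n} {m : ℝ≥0} (h : S.links s(x, y) = some m) (a b : ℝ≥0)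
    (best : ℝ≥0∞) : (S.relax x a y b best).val ≤ a + m + b := by
  unfold relax
  simp only [Timed.val_bind, Timed.val_op, h]
  push_cast
  exact min_le_right _ _

theorem le_relax_val {D : ℝ≥0∞} {x y : Fin n} {a b : ℝ≥0} {best : ℝ≥0∞} (hbest : D ≤ best)
    (h : ∀ m, S.links s(x, y) = some m → D ≤ a + m + b) : D ≤ (S.relax x a y b best).val := by
  unfold relax
  simp only [Timed.val_bind, Timed.val_op]
  split
  · exact hbest
  · rename_i m hm
    simpa using ⟨hbest, h m hm⟩

theorem scanLast_val_le_best (x : Fin n) (a : ℝ≥0) (l : List (Fin n × ℝ≥0)) (best : ℝ≥0∞) :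
    (S.scanLast x a l best).val ≤ best := by
  induction l generalizing best with
  | nil => simp [scanLast]
  | cons e l ih => exact (ih _).trans (S.relax_val_le_best _ _ _ _ _)

theorem scanLast_val_le {x y : Fin n} {m : ℝ≥0} (h : S.links s(x, y) = some m) (a : ℝ≥0) {b : ℝ≥0}
    {l : List (Fin n × ℝ≥0)} (hl : (y, b) ∈ l) (best : ℝ≥0∞) :
    (S.scanLast x a l best).val ≤ a + m + b := by
  induction l generalizing best with
  | nil => simp at hl
  | cons e l ih =>
    rcases List.mem_cons.1 hl with rfl | hl
    · exact (S.scanLast_val_le_best x a l _).trans (relax_val_le h a b best)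
    · exact ih hl _

theorem le_scanLast_val {D : ℝ≥0∞} {x : Fin n} {a : ℝ≥0} {l : List (Fin n × ℝ≥0)} {best : ℝ≥0∞}
    (hbest : D ≤ best)
    (h : ∀ y b m, (y, b) ∈ l → S.links s(x, y) = some m → D ≤ a + m + b) :
    D ≤ (S.scanLast x a l best).val := by
  induction l generalizing best with
  | nil => exact hbest
  | cons e l ih =>
    exact ih (le_relax_val hbest fun m => h e.1 e.2 m (by simp))
      fun y b m hyb => h y b m (List.mem_cons_of_mem _ hyb)

theorem scanFirst_val_le_best (v : Fin n) (l : List (Fin n × ℝ≥0)) (best : ℝ≥0∞) :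
    (S.scanFirst v l best).val ≤ best := by
  induction l generalizing best with
  | nil => simp [scanFirst]
  | cons e l ih => exact (ih _).trans (S.scanLast_val_le_best _ _ _ _)

theorem scanFirst_val_le {v x y : Fin n} {a b m : ℝ≥0} (h : S.links s(x, y) = some m)
    (hv : (y, b) ∈ S.hops v) {l : List (Fin n × ℝ≥0)} (hl : (x, a) ∈ l) (best : ℝ≥0∞) :
    (S.scanFirst v l best).val ≤ a + m + b := by
  induction l generalizing best with
  | nil => simp at hl
  | cons e l ih =>
    rcases List.mem_cons.1 hl with rfl | hl
    · exact (S.scanFirst_val_le_best v l _).trans (scanLast_val_le h a hv best)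
    · exact ih hl _

theorem le_scanFirst_val {D : ℝ≥0∞} {v : Fin n} {l : List (Fin n × ℝ≥0)} {best : ℝ≥0∞}
    (hbest : D ≤ best) (h : ∀ x a y b m, (x, a) ∈ l → (y, b) ∈ S.hops v →
      S.links s(x, y) = some m → D ≤ a + m + b) :
    D ≤ (S.scanFirst v l best).val := by
  induction l generalizing best with
  | nil => exact hbest
  | cons e l ih =>
    exact ih (le_scanLast_val hbest fun y b m => h e.1 e.2 y b m (by simp))
      fun x a y b m hxa => h x a y b m (List.mem_cons_of_mem _ hxa)

/-- The covering pair attains the distance, and by the triangle inequality no candidate is below it.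
-/
theorem IsThreeHopsetOracle.query_val {G : WeightedGraph (Fin n)} (hS : S.IsThreeHopsetOracle G)
    (u v : Fin n) : (S.query u v).val = G.dist u v := by
  refine le_antisymm ?_ (le_scanFirst_val le_top ?_)
  · by_cases h : G.dist u v = ⊤
    · exact h ▸ le_top
    obtain ⟨x, y, a, b, hx, hy, hxy, heq⟩ := hS.covers u v h
    obtain ⟨m, hm⟩ := Option.isSome_iff_exists.1 hxy
    refine (scanFirst_val_le hm hy hx ⊤).trans_eq ?_
    rw [heq, hS.hops_length _ _ _ hx, hS.links_length _ _ _ hm, hS.hops_length _ _ _ hy,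
      G.dist_comm v y]
  · intro x a y b m hx hy hm
    rw [hS.hops_length _ _ _ hx, hS.links_length _ _ _ hm, hS.hops_length _ _ _ hy,
      G.dist_comm v y]
    exact (G.dist_triangle u y v).trans (add_le_add_left (G.dist_triangle u x y) _)

/-! ### The store built from the hops. -/

open Classical in
/-- The store whose first/last-hop neighbours and middle hops are those of `N` and `H` that are at
finite distance. -/
noncomputable def ofFinsets (G : WeightedGraph (Fin n)) (N : Fin n → Finset (Fin n))
    (H : Finset (Sym2 (Fin n))) : Store n where
  hops w := ((N w).filter fun x => G.dist w x ≠ ⊤).toList.map fun x => (x, (G.dist w x).toNNReal)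
  links e :=
    if e ∈ H ∧ Sym2.lift ⟨G.dist, G.dist_comm⟩ e ≠ ⊤ then
      some (Sym2.lift ⟨G.dist, G.dist_comm⟩ e).toNNReal
    else none

variable {G : WeightedGraph (Fin n)} {N : Fin n → Finset (Fin n)} {H : Finset (Sym2 (Fin n))}

theorem mem_hops_ofFinsets {w x : Fin n} {d : ℝ≥0} :
    (x, d) ∈ (ofFinsets G N H).hops w ↔ x ∈ N w ∧ (d : ℝ≥0∞) = G.dist w x := by
  simp only [ofFinsets, List.mem_map, Finset.mem_toList, Finset.mem_filter, Prod.mk.injEq]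
  constructor
  · rintro ⟨x, ⟨hx, hd⟩, rfl, rfl⟩
    exact ⟨hx, ENNReal.coe_toNNReal hd⟩
  · rintro ⟨hx, hd⟩
    exact ⟨x, ⟨hx, hd ▸ ENNReal.coe_ne_top⟩, rfl, by rw [← hd, ENNReal.toNNReal_coe]⟩

theorem links_ofFinsets {x y : Fin n} {d : ℝ≥0} :
    (ofFinsets G N H).links s(x, y) = some d ↔ s(x, y) ∈ H ∧ (d : ℝ≥0∞) = G.dist x y := by
  by_cases h : s(x, y) ∈ H ∧ G.dist x y ≠ ⊤
  · have hsome : (ofFinsets G N H).links s(x, y) = some (G.dist x y).toNNReal := if_pos h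
    rw [hsome, Option.some.injEq]
    constructor
    · rintro rfl
      exact ⟨h.1, ENNReal.coe_toNNReal h.2⟩
    · rintro ⟨-, hd⟩
      rw [← hd, ENNReal.toNNReal_coe]
  · have hnone : (ofFinsets G N H).links s(x, y) = none := if_neg h
    rw [hnone]
    simp only [reduceCtorEq, false_iff]
    rintro ⟨h1, hd⟩
    exact h ⟨h1, hd ▸ ENNReal.coe_ne_top⟩

theorem length_hops_ofFinsets_le (w : Fin n) :
    ((ofFinsets G N H).hops w).length ≤ (N w).card := by
  simp only [ofFinsets, List.length_map, Finset.length_toList]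
  exact Finset.card_filter_le _ _

theorem ncard_H₂_ofFinsets_le : (ofFinsets G N H).H₂.ncard ≤ H.card := by
  rw [← Set.ncard_coe_finset]
  refine Set.ncard_le_ncard (fun e he => ?_) (Finset.finite_toSet _)
  by_contra hH
  have hnone : (ofFinsets G N H).links e = none := if_neg fun h => hH h.1
  have he' : ((ofFinsets G N H).links e).isSome := he
  rw [hnone] at he'
  exact Bool.false_ne_true he'

theorem isThreeHopsetOracle_ofFinsets (hsplit : SplitsWalks G.graph Finset.univ N H) :
    (ofFinsets G N H).IsThreeHopsetOracle G := by
  have hcov : ∀ u v, G.dist u v ≠ ⊤ → ∃ x y a b, (x, a) ∈ (ofFinsets G N H).hops u ∧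
      (y, b) ∈ (ofFinsets G N H).hops v ∧ s(x, y) ∈ (ofFinsets G N H).H₂ ∧
      G.dist u v = G.dist u x + G.dist x y + G.dist y v := by
    intro u v h
    obtain ⟨p, -, hp⟩ := G.exists_isPath_walkLength_eq_dist h
    obtain ⟨x, hx, y, hy, hxy, p₁, p₂, p₃, rfl⟩ := hsplit u v p fun _ _ => Finset.mem_univ _
    -- The three parts of a shortest path bound the three distances from above, which turns the
    -- triangle inequality into an equality.
    have heq : G.dist u v = G.dist u x + G.dist x y + G.dist y v := by
      refine le_antisymm ((G.dist_triangle u y v).trans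
        (add_le_add_left (G.dist_triangle u x y) _)) ?_
      rw [← hp, walkLength_append, walkLength_append, ← add_assoc]
      exact add_le_add (add_le_add (G.dist_le_walkLength _) (G.dist_le_walkLength _))
        (G.dist_le_walkLength _)
    have hfin := h
    rw [heq, ENNReal.add_ne_top, ENNReal.add_ne_top] at hfin
    refine ⟨x, y, _, _, mem_hops_ofFinsets.2 ⟨hx, ENNReal.coe_toNNReal hfin.1.1⟩,
      mem_hops_ofFinsets.2 ⟨hy, ENNReal.coe_toNNReal (G.dist_comm y v ▸ hfin.2)⟩,
      Option.isSome_iff_exists.2 ⟨_, links_ofFinsets.2 ⟨hxy, ENNReal.coe_toNNReal hfin.1.2⟩⟩, heq⟩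
  refine ⟨fun w x d h => (mem_hops_ofFinsets.1 h).2, fun x y d h => (links_ofFinsets.1 h).2,
    WeightedGraph.isHopset_three ?_ ?_, hcov⟩
  · rintro u v (⟨w, x, d, h, he⟩ | h)
    · have hd := (mem_hops_ofFinsets.1 h).2
      rcases Sym2.eq_iff.1 he with ⟨rfl, rfl⟩ | ⟨rfl, rfl⟩
      · exact hd ▸ ENNReal.coe_ne_top
      · rw [G.dist_comm]
        exact hd ▸ ENNReal.coe_ne_top
    · obtain ⟨d, hd⟩ := Option.isSome_iff_exists.1 h
      exact (links_ofFinsets.1 hd).2 ▸ ENNReal.coe_ne_top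
  · intro u v h
    obtain ⟨x, y, a, b, hx, hy, hxy, heq⟩ := hcov u v h
    exact ⟨x, y, .inl ⟨u, x, a, hx, rfl⟩, .inr hxy, .inl ⟨v, y, b, hy, Sym2.eq_swap⟩, heq⟩

end Store

/-! ### Recursion depth and final constants. -/

/-- The recursion depth needed for `n` vertices is `O(log log n)`. -/
theorem exists_depth {n : ℕ} (hn : 3 ≤ n) :
    ∃ k : ℕ, n ≤ 2 ^ 2 ^ k ∧ ((k : ℝ) + 1) ≤ 5 * Real.logb 2 (Real.logb 2 n) := by
  have hn' : (3 : ℝ) ≤ n := by exact_mod_cast hn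
  have h1 : (3 / 2 : ℝ) ≤ Real.logb 2 n := by
    have h3 : (3 / 2 : ℝ) ≤ Real.logb 2 3 := by
      have := Real.logb_le_logb_of_le (b := 2) (by norm_num) (by norm_num : (0 : ℝ) < 2 ^ 3)
        (by norm_num : (2 : ℝ) ^ 3 ≤ 3 ^ 2)
      rw [Real.logb_pow, Real.logb_pow, Real.logb_self_eq_one (by norm_num)] at this
      norm_num at this
      linarith
    exact h3.trans (Real.logb_le_logb_of_le (by norm_num) (by norm_num) hn')
  have h2 : (1 / 2 : ℝ) ≤ Real.logb 2 (Real.logb 2 n) := by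
    have h3 : (1 / 2 : ℝ) ≤ Real.logb 2 (3 / 2) := by
      have := Real.logb_le_logb_of_le (b := 2) (by norm_num) (by norm_num : (0 : ℝ) < 2)
        (by norm_num : (2 : ℝ) ≤ (3 / 2) ^ 2)
      rw [Real.logb_pow, Real.logb_self_eq_one (by norm_num)] at this
      norm_num at this
      linarith
    exact h3.trans (Real.logb_le_logb_of_le (by norm_num) (by norm_num) h1)
  refine ⟨⌈Real.logb 2 (Real.logb 2 n)⌉₊, ?_, ?_⟩
  · have h3 := Nat.le_ceil (Real.logb 2 (Real.logb 2 n))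
    rw [Real.logb_le_iff_le_rpow (by norm_num) (by linarith), Real.rpow_natCast] at h3
    rw [Real.logb_le_iff_le_rpow (by norm_num) (by linarith)] at h3
    have h4 : ((2 : ℝ) ^ ⌈Real.logb 2 (Real.logb 2 n)⌉₊) =
        ((2 ^ ⌈Real.logb 2 (Real.logb 2 n)⌉₊ : ℕ) : ℝ) := by push_cast; rfl
    rw [h4, Real.rpow_natCast] at h3
    exact_mod_cast h3
  -- With L for the double logarithm, the ceiling plus 1 is below L + 2, and L + 2 ≤ 5 L because L ≥
  -- 1/2.
  · have := Nat.ceil_lt_add_one (by linarith : 0 ≤ Real.logb 2 (Real.logb 2 n))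
    linarith

end HopOracle

theorem mainTheorem6 :
    ∃ C : ℝ, 0 < C ∧
      ∀ (n t : ℕ), 3 ≤ n → 1 ≤ t →
      ∀ G : HopOracle.WeightedGraph (Fin n), HopOracle.HasTreewidth G.graph t →
      ∃ S : HopOracle.Store n,
        S.IsThreeHopsetOracle G ∧
        -- the number of stored edges
        (S.size G : ℝ) ≤ C * (t * n * Real.logb 2 (Real.logb 2 n)) ∧
        -- the number of first/last-hop neighbours of every vertex
        (∀ w, ((S.hops w).length : ℝ) ≤ C * (t * Real.logb 2 (Real.logb 2 n))) ∧
        -- correctness and time of every query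
        (∀ u v, (S.query u v).val = G.dist u v ∧
          ((S.query u v).time : ℝ) ≤ C * (t ^ 2 * Real.logb 2 (Real.logb 2 n) ^ 2)) ∧
        -- for integer weights bounded by a power of `n`, a stored edge takes `O(log n)` bits:
        -- its two vertices and its length fit into words of `O(log n)` bits
        (∀ c : ℕ,
          (∀ u v, G.graph.Adj u v → ∃ k : ℕ, k ≤ n ^ c ∧ G.weight u v = k) →
          ∃ b : ℕ, (b : ℝ) ≤ C * ((c + 1) * Real.logb 2 n) ∧
            ∀ r ∈ S.records G, (r.1 : ℕ) < 2 ^ b ∧ (r.2.1 : ℕ) < 2 ^ b ∧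
              ∃ k : ℕ, k < 2 ^ b ∧ r.2.2 = k) := by
  -- The query time dictates 700 = 28 · 5², with the 5 from `exists_depth`; the other bounds need
  -- less.
  refine ⟨700, by norm_num, fun n t hn ht G hG => ?_⟩
  obtain ⟨E⟩ := hG.nonempty_eliminationOrder
  obtain ⟨k, hk, hk'⟩ := HopOracle.exists_depth hn
  obtain ⟨N, H, hN, hH, hsplit⟩ := E.exists_splitsWalks ht k Finset.univ (by
    rw [Finset.card_univ, Fintype.card_fin]
    exact hk.trans (Nat.le_mul_of_pos_left _ ht))
  rw [Finset.card_univ, Fintype.card_fin] at hH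
  let S := HopOracle.Store.ofFinsets G N H
  have hS : S.IsThreeHopsetOracle G := HopOracle.Store.isThreeHopsetOracle_ofFinsets hsplit
  have hlen : ∀ w, (S.hops w).length ≤ 2 * t * (k + 1) := fun w =>
    (HopOracle.Store.length_hops_ofFinsets_le w).trans (hN w)
  have ht' : (1 : ℝ) ≤ t := by exact_mod_cast ht
  have hn' : (3 : ℝ) ≤ n := by exact_mod_cast hn
  set L : ℝ := Real.logb 2 (Real.logb 2 n)
  have hk0 : (0 : ℝ) ≤ k := Nat.cast_nonneg k
  refine ⟨S, hS, ?_, fun w => ?_, fun u v => ⟨hS.query_val u v, ?_⟩, fun c hc => ?_⟩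
  -- 19 = 1 + 2 + 16, for the edges of the graph, the first/last hops and the middle hops.
  · have h1 : S.size G ≤ 19 * (t * n * (k + 1)) := by
      have h2 : ∑ w, (S.hops w).length ≤ ∑ _w : Fin n, 2 * t * (k + 1) :=
        Finset.sum_le_sum fun w _ => hlen w
      rw [Finset.sum_const, Finset.card_univ, Fintype.card_fin, smul_eq_mul] at h2
      have h3 : S.H₂.ncard ≤ 16 * t * n * (k + 1) :=
        HopOracle.Store.ncard_H₂_ofFinsets_le.trans hH
      have h4 : t * n ≤ t * n * (k + 1) := Nat.le_mul_of_pos_right _ k.succ_pos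
      calc S.size G ≤ t * n * (k + 1) + n * (2 * t * (k + 1)) + 16 * t * n * (k + 1) :=
            add_le_add (add_le_add (E.ncard_edgeSet_le.trans h4) h2) h3
        _ = 19 * (t * n * (k + 1)) := by ring
    have h2 : (S.size G : ℝ) ≤ 19 * (t * n * (k + 1)) := by exact_mod_cast h1
    have h3 : (t * n * (k + 1) : ℝ) ≤ t * n * (5 * L) := by gcongr
    have h4 : (0 : ℝ) ≤ t * n * (k + 1) := by positivity
    linarith
  · have h1 : ((S.hops w).length : ℝ) ≤ 2 * t * (k + 1) := by exact_mod_cast hlen w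
    have h2 : (t * (k + 1) : ℝ) ≤ t * (5 * L) := by gcongr
    have h3 : (0 : ℝ) ≤ t * (k + 1) := by positivity
    linarith
  · have h1 : (S.query u v).time ≤ 28 * (t * (k + 1)) ^ 2 := by
      have h2 : 1 ≤ t * (k + 1) := Nat.mul_pos ht k.succ_pos
      have h3 := hlen u
      have h4 := hlen v
      rw [mul_assoc] at h3 h4
      calc _ ≤ (S.hops u).length * (5 * (S.hops v).length + 3) + 2 := S.query_time_le u v
        _ ≤ 2 * (t * (k + 1)) * (5 * (2 * (t * (k + 1))) + 3) + 2 := by gcongr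
        _ ≤ 28 * (t * (k + 1)) ^ 2 := by nlinarith
    have h2 : ((S.query u v).time : ℝ) ≤ 28 * (t * (k + 1)) ^ 2 := by exact_mod_cast h1
    have h3 : ((t * (k + 1)) ^ 2 : ℝ) ≤ (t * (5 * L)) ^ 2 := by gcongr
    calc _ ≤ _ := h2
      _ ≤ 28 * (t * (5 * L)) ^ 2 := by linarith
      _ = 700 * (t ^ 2 * L ^ 2) := by ring
  · have hlog : 1 ≤ Nat.log 2 n := Nat.log_pos one_lt_two (by omega)
    -- Finite distances are below `n * n ^ c`, so this word length suffices for them as well as for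
    -- vertices and weights.
    have hb : n ^ (c + 1) < 2 ^ ((c + 1) * (Nat.log 2 n + 1)) := by
      rw [mul_comm, pow_mul]
      exact Nat.pow_lt_pow_left (Nat.lt_pow_succ_log_self one_lt_two n) c.succ_ne_zero
    have hnb : n ≤ n ^ (c + 1) := Nat.le_self_pow c.succ_ne_zero n
    have hdist : ∀ (x y : Fin n) (d : NNReal), (d : ENNReal) = G.dist x y →
        ∃ k : ℕ, k < 2 ^ ((c + 1) * (Nat.log 2 n + 1)) ∧ d = k := by
      intro x y d hd
      obtain ⟨k, hk, hk'⟩ := HopOracle.WeightedGraph.exists_nat_dist (Nat.one_le_pow _ _ (by omega))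
        hc (hd ▸ ENNReal.coe_ne_top : G.dist x y ≠ ⊤)
      refine ⟨k, hk.trans ?_, ?_⟩
      · rwa [mul_comm, ← pow_succ]
      · rw [hk'] at hd
        exact_mod_cast hd
    refine ⟨(c + 1) * (Nat.log 2 n + 1), ?_, ?_⟩
    · have h1 : (Nat.log 2 n : ℝ) ≤ Real.logb 2 n := by
        have := Real.natLog_le_logb n 2
        exact_mod_cast this
      have h2 : (1 : ℝ) ≤ Nat.log 2 n := by exact_mod_cast hlog
      have h3 : ((c : ℝ) + 1) * (Nat.log 2 n + 1) ≤ (c + 1) * (700 * Real.logb 2 n) := by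
        gcongr
        linarith
      push_cast
      linarith
    · rintro ⟨x, y, d⟩ hr
      refine ⟨(x.2.trans_le hnb).trans hb, (y.2.trans_le hnb).trans hb, ?_⟩
      rcases hr with ⟨hadj, hd⟩ | h | h
      · obtain ⟨k, hk, hk'⟩ := hc x y hadj
        refine ⟨k, hk.trans_lt (lt_of_le_of_lt ?_ hb), hd.trans hk'⟩
        exact Nat.pow_le_pow_right (by omega) c.le_succ
      · exact hdist x y d (hS.hops_length x y d h)
      · exact hdist x y d (hS.links_length x y d h)
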